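/- Fix an integer $K \ge 0$ and a probability space. For an integer $d$ and a sequence $x = (x_n)_{n\in\mathbb Z}$ of vectors of $\mathbb C^d$, and for integers $N \ge 1$, $B \ge 0$ with $B$ even and $\nu \in \mathbb R$, put $$\xi_x(\nu) = \frac{1}{\sqrt N}\sum_{n=0}^{N-1} x_n e^{-2i\pi\nu n}, \qquad \Sigma_x(\nu) = \frac{1}{\sqrt{B+1}}\Bigl[\xi_x\bigl(\nu - \tfrac{B}{2N}\bigr), \xi_x\bigl(\nu - \tfrac{B}{2N} + \tfrac1N\bigr), \ldots, \xi_x\bigl(\nu+\tfrac{B}{2N}\bigr)\Bigr] \in \mathbb C^{d\times(B+1)} .$$ Let $\|\cdot\|_2$ be the spectral norm of matrices (Euclidean norm of vectors). For each $M\ge 1$ let $(\mathbf H_k)_{k\in\mathbb Z} = (\mathbf H_k^{(M)})_{k \in \mathbb Z}$ be a filter with $\mathbf H_k\in\mathbb C^{M\times K}$, let $\mathbf H(\nu)=\sum_{k\in\mathbb Z}\mathbf H_k e^{-2i\pi\nu k}$, with rows $\mathbf h^1(\nu),\dots,\mathbf h^M(\nu)$, and assume $$\sup_{M\ge1}\sum_{k\in\mathbb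 Z}(1+|k|)\,\|\mathbf H_k\|_2<\infty, \qquad \lim_{M\to\infty}\max_{m=1,\dots,M}\max_{\nu\in[0,1]}\|\mathbf h^m(\nu)\|_2=0 .$$ For each $M \ge 1$ let $(\boldsymbol\epsilon_n)_{n\in\mathbb Z}$ be a $K$-dimensional complex Gaussian white noise, i.e. the $\boldsymbol\epsilon_n$ are independent and $\boldsymbol\epsilon_n \sim \mathcal N_{\mathbb C^K}(\mathbf 0, \mathbf I_K)$ (circular), defined on the fixed probability space. It may be the same noise for all $M$, or depend on $M$, in which case nothing is assumed on the joint law of the noises for different $M$. Let $(\mathbf u_n)_{n\in\mathbb Z}$ be the $M$-dimensional process such that, for each $n$, $$\mathbf u_n=\sum_{k\in\mathbb Z}\mathbf H_k\boldsymbol\epsilon_{n-k}\quad\text{with probability one.}$$ Let $N=N(M)$ and $B=B(M)$ be integer-valued functions of $M$, with $B$ even, such that for some $\alpha\in(0,1)$ and some $c\in(0,1)$ $$M=\mathcal O(N^\alpha)\quad\text{and}\quad \frac MB\xrightarrow[M\to\infty]{}c,$$ and let $\mathcal V_N=\{k/N : k=0,\dots,N-1\}$ be the set of Fourier frequencies.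 Then, almost surely, $$\max_{\nu\in\mathcal V_N}\bigl\|\Sigma_{\mathbf u}(\nu)-\mathbf H(\nu)\,\Sigma_{\boldsymbol\epsilon}(\nu)\bigr\|_2\xrightarrow[M\to\infty]{}0 .$$ -/

import Mathlib

open MeasureTheory ProbabilityTheory Filter Topology Asymptotics
open scoped NNReal Matrix Matrix.Norms.L2Operator

-- Matrices carry the spectral norm (the operator norm between Euclidean spaces).

noncomputable section

/-- The circular complex Gaussian distribution with mean `0` and variance `v`: the real and
imaginary parts are independent, centred, real Gaussian of variance `v / 2`. -/
def complexGaussian (v : ℝ≥0) : Measure ℂ :=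
  ((gaussianReal 0 (v / 2)).prod (gaussianReal 0 (v / 2))).map fun p => (⟨p.1, p.2⟩ : ℂ)

/-- The random vector `x` is circular complex Gaussian, centred with covariance matrix `R`:
for every deterministic vector `b`, the scalar `b^* x` is circular complex Gaussian with
variance `b^* R b`. -/
def IsComplexGaussianVector {Ω : Type*} [MeasurableSpace Ω] {K : ℕ} (x : Ω → Fin K → ℂ)
    (R : Matrix (Fin K) (Fin K) ℂ) (P : Measure Ω) : Prop :=
  ∀ b : Fin K → ℂ,
    HasLaw (fun ω => star b ⬝ᵥ x ω) (complexGaussian (star b ⬝ᵥ R *ᵥ b).re.toNNReal) P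

/-- `(ε n)`, `n ∈ ℤ`, is a `K`-dimensional complex Gaussian white noise with
`𝔼[ε n (ε n)^*] = I`: independent random vectors, each circular complex Gaussian, centred,
with identity covariance matrix. -/
structure IsComplexGaussianWhiteNoise {Ω : Type*} [MeasurableSpace Ω] {K : ℕ}
    (ε : ℤ → Ω → Fin K → ℂ) (P : Measure Ω) : Prop where
  measurable : ∀ n, Measurable (ε n)
  indep : iIndepFun ε P
  gaussian : ∀ n, IsComplexGaussianVector (ε n) 1 P

/-- The phase `exp (-2 i π ν n)`. -/
def phase (ν : ℝ) (n : ℤ) : ℂ :=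
  Complex.exp (-(2 * Real.pi * Complex.I * ν * n))

/-- The Fourier transform `H(ν) = ∑ k ∈ ℤ, H_k exp (-2 i π ν k)` of a matrix filter. -/
def transferFunction {M K : ℕ} (H : ℤ → Matrix (Fin M) (Fin K) ℂ) (ν : ℝ) :
    Matrix (Fin M) (Fin K) ℂ :=
  ∑' k : ℤ, phase ν k • H k

/-- The Euclidean norm of row `m` of a matrix. -/
def rowNorm {M K : ℕ} (A : Matrix (Fin M) (Fin K) ℂ) (m : Fin M) : ℝ :=
  ‖(WithLp.toLp 2 (fun j => A m j) : EuclideanSpace ℂ (Fin K))‖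

/-- The conditions on the family of MIMO filters `(H M k)`, `k ∈ ℤ`, indexed by `M`. -/
structure MIMOFilterConditions {K : ℕ} (H : (M : ℕ) → ℤ → Matrix (Fin M) (Fin K) ℂ) : Prop where
  /-- `sup_{M ≥ 1} ∑_k (1 + |k|) ‖H_k‖₂ < ∞` -/
  memory : ∃ C : ℝ, ∀ M : ℕ, 1 ≤ M →
    Summable (fun k : ℤ => (1 + |(k : ℝ)|) * ‖H M k‖) ∧
      ∑' k : ℤ, (1 + |(k : ℝ)|) * ‖H M k‖ ≤ C
  /-- `max_m max_{ν ∈ [0,1]} ‖h^m(ν)‖₂ → 0` as `M → ∞`, with `h^m(ν)` the rows of `H(ν)` -/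
  power : Tendsto
    (fun M : ℕ => ⨆ m : Fin M, ⨆ ν : Set.Icc (0 : ℝ) 1, rowNorm (transferFunction (H M) ν) m)
    atTop (𝓝 0)

/-- The high-dimensional regime for the sample size `N = N(M)` and the (even) smoothing span
`B = B(M)`. -/
structure HighDimensionalRegime (N B : ℕ → ℕ) : Prop where
  even_span : ∀ M, Even (B M)
  sample_size : ∃ α : ℝ, 0 < α ∧ α < 1 ∧
    (fun M : ℕ => (M : ℝ)) =O[atTop] fun M : ℕ => (N M : ℝ) ^ α
  ratio : ∃ c : ℝ, 0 < c ∧ c < 1 ∧ Tendsto (fun M : ℕ => (M : ℝ) / (B M : ℝ)) atTop (𝓝 c)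

/-- The set of Fourier frequencies `{k / N : k = 0, …, N - 1}`. -/
def fourierFrequencies (N : ℕ) : Set ℝ :=
  {ν | ∃ k : ℕ, k < N ∧ ν = (k : ℝ) / N}

/-- The normalized finite Fourier transform
`ξ_x(ν) = N^{-1/2} ∑_{n=0}^{N-1} x_n exp (-2 i π ν n)` of a vector-valued sequence. -/
def finiteFourier {d : ℕ} (N : ℕ) (x : ℤ → Fin d → ℂ) (ν : ℝ) : Fin d → ℂ :=
  ((Real.sqrt N : ℝ) : ℂ)⁻¹ • ∑ n ∈ Finset.range N, phase ν n • x n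

/-- The `d × (B + 1)` matrix
`Σ_x(ν) = (B + 1)^{-1/2} [ξ_x(ν - B / (2 N)), …, ξ_x(ν + B / (2 N))]`; its columns are indexed
by `j = 0, …, B`, column `j` being at the frequency `ν + b / N` with `b = j - B / 2`. -/
def smoothedFourier {d : ℕ} (N B : ℕ) (x : ℤ → Fin d → ℂ) (ν : ℝ) :
    Matrix (Fin d) (Fin (B + 1)) ℂ :=
  Matrix.of fun i j => ((Real.sqrt ((B : ℝ) + 1) : ℝ) : ℂ)⁻¹ *
    finiteFourier N x (ν + ((j : ℝ) - (B : ℝ) / 2) / N) i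

end

/-!
The column of `Σ_u(ν) - H(ν) Σ_ε(ν)` at the frequency `f` splits as
`(ξ_u(f) - H(f) ξ_ε(f)) + (H(f) - H(ν)) ξ_ε(f)`, up to the factor `(B + 1)^{-1/2}`.

In `ξ_u(f) - H(f) ξ_ε(f)`, the term of lag `k` compares the sums of `exp (-2 i π f n) ε_n` over
`[-k, N - k)` and over `[0, N)`. These windows differ in at most `2 |k|` indices, so the memory
condition `∑_k (1 + |k|) ‖H_k‖ ≤ C` bounds the norm of this edge effect in `L^p` by a multiple of
`C / √N`, uniformly in `f`. The same condition makes `H` Lipschitz, whence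
`‖H(f) - H(ν)‖ ≤ π C B / N`, and by Parseval's identity the sum of `‖ξ_ε(f)‖²` over the
`B + 1 ≤ N` frequencies `f` is at most the sum of `‖ε_n‖²` over `0 ≤ n < N`.

Both bounds are uniform in `ν` and are `O(√((B + 1) / N))` in `L^p`. Since `(B + 1) / N` decays like
a negative power of `M`, the `p`-th moments are summable once `p` is large, and Borel–Cantelli
applies. The noise enters only through the bound on its moments of order `p`.
-/

open scoped ENNReal

local notation "‖" x "‖₂" => ‖(WithLp.toLp 2 x : EuclideanSpace ℂ _)‖

section LpNorm

variable {Ω : Type*} [MeasurableSpace Ω] {P : Measure Ω} {E : Type*} [NormedAddCommGroup E]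

theorem eLpNorm_tsum_le [CompleteSpace E] {ι : Type*} [Countable ι] {p : ℝ≥0∞} (hp : 1 ≤ p)
    {f : ι → Ω → E} (hf : ∀ i, AEStronglyMeasurable (f i) P) :
    eLpNorm (fun ω => ∑' i, f i ω) p P ≤ ∑' i, eLpNorm (f i) p P := by
  by_cases hfin : ∑' i, eLpNorm (f i) p P = ∞
  · exact hfin ▸ le_top
  refine Lp.eLpNorm_le_of_ae_tendsto (u := atTop) (f := fun s : Finset ι => ∑ i ∈ s, f i)
    (Eventually.of_forall fun s =>
      (eLpNorm_sum_le (fun i _ => hf i) hp).trans (ENNReal.sum_le_tsum s))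
    (fun s => Finset.aestronglyMeasurable_sum s fun i _ => hf i) ?_
  filter_upwards [summable_norm_of_tsum_eLpNorm_ne_top hp hf hfin] with ω hω
  simpa only [HasSum, Finset.sum_apply, SummationFilter.unconditional_filter] using
    hω.of_norm.hasSum

theorem eLpNorm_norm_sq (f : Ω → E) {p : ℝ≥0} :
    eLpNorm (fun ω => ‖f ω‖ ^ 2) (p / 2) P = eLpNorm f p P ^ 2 := by
  have h := eLpNorm_norm_rpow (μ := P) (p := p / 2) f two_pos
  simpa [ENNReal.div_mul_cancel] using h

theorem eLpNorm_sqrt_mean_sq_le {ι : Type*} (s : Finset ι) {p : ℝ≥0} (hp : 2 ≤ p)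
    {f : ι → Ω → E} (hf : ∀ i, AEStronglyMeasurable (f i) P) {m : ℝ≥0}
    (hm : ∀ i, eLpNorm (f i) p P ≤ m) :
    eLpNorm (fun ω => √((∑ i ∈ s, ‖f i ω‖ ^ 2) / s.card)) p P ≤ m := by
  have hp2 : (1 : ℝ≥0∞) ≤ p / 2 := by
    rw [ENNReal.le_div_iff_mul_le (by simp) (by simp), one_mul]
    exact_mod_cast hp
  have hsum : eLpNorm (∑ i ∈ s, fun ω => ‖f i ω‖ ^ 2) (p / 2) P ≤ s.card * (m : ℝ≥0∞) ^ 2 := by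
    refine (eLpNorm_sum_le (fun i _ => (hf i).norm.pow 2) hp2).trans ?_
    rw [← nsmul_eq_mul]
    refine Finset.sum_le_card_nsmul _ _ _ fun i _ => ?_
    calc eLpNorm (fun ω => ‖f i ω‖ ^ 2) (p / 2) P = eLpNorm (f i) p P ^ 2 := eLpNorm_norm_sq _
      _ ≤ (m : ℝ≥0∞) ^ 2 := by gcongr; exact hm i
  have hmean : eLpNorm (fun ω => (∑ i ∈ s, ‖f i ω‖ ^ 2) / s.card) (p / 2) P ≤ (m : ℝ≥0∞) ^ 2 := by
    have hcard : ‖(s.card : ℝ)⁻¹‖ₑ * s.card ≤ 1 := by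
      rw [← Real.enorm_natCast s.card, ← enorm_mul, Real.enorm_eq_ofReal (by positivity)]
      exact ENNReal.ofReal_le_one.2 inv_mul_le_one
    calc _ = eLpNorm ((s.card : ℝ)⁻¹ • ∑ i ∈ s, fun ω => ‖f i ω‖ ^ 2) (p / 2) P := by
          congr 1
          ext ω
          simp [div_eq_inv_mul]
      _ ≤ ‖(s.card : ℝ)⁻¹‖ₑ * (s.card * (m : ℝ≥0∞) ^ 2) := by
          rw [eLpNorm_const_smul]
          gcongr
      _ ≤ (m : ℝ≥0∞) ^ 2 := by
          rw [← mul_assoc]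
          exact mul_le_of_le_one_left' hcard
  rw [← ENNReal.pow_le_pow_left_iff two_ne_zero, ← eLpNorm_norm_sq]
  refine (eLpNorm_congr_ae (.of_forall fun ω => ?_)).trans_le hmean
  have : 0 ≤ (∑ i ∈ s, ‖f i ω‖ ^ 2) / (s.card : ℝ) := by positivity
  simp only [Real.norm_eq_abs, sq_abs, Real.sq_sqrt this]

theorem ae_tendsto_zero_of_eventually_eLpNorm_le {p : ℝ≥0} (hp : p ≠ 0) {f : ℕ → Ω → E}
    (hf : ∀ n, AEStronglyMeasurable (f n) P) {a : ℕ → ℝ≥0∞}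
    (ha : ∑' n, a n ^ (p : ℝ) ≠ ∞) (hfa : ∀ᶠ n in atTop, eLpNorm (f n) p P ≤ a n) :
    ∀ᵐ ω ∂P, Tendsto (fun n => f n ω) atTop (𝓝 0) := by
  have hp0 : 0 < (p : ℝ) := by positivity
  obtain ⟨n₀, hn₀⟩ := eventually_atTop.1 hfa
  have hmeas : ∀ n, AEMeasurable (fun ω => ‖f (n + n₀) ω‖ₑ ^ (p : ℝ)) P := fun n =>
    (hf _).enorm.pow_const _
  have hfin : ∫⁻ ω, ∑' n, ‖f (n + n₀) ω‖ₑ ^ (p : ℝ) ∂P ≠ ∞ := by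
    rw [lintegral_tsum hmeas]
    refine ne_top_of_le_ne_top ha ((ENNReal.tsum_le_tsum fun n => ?_).trans
      (ENNReal.tsum_comp_le_tsum_of_injective (add_left_injective n₀) fun n => a n ^ (p : ℝ)))
    rw [← eLpNorm_nnreal_pow_eq_lintegral hp]
    gcongr
    exact hn₀ _ (Nat.le_add_left _ _)
  filter_upwards [ae_lt_top' (AEMeasurable.tsum hmeas) hfin] with ω hω
  have hpow := ENNReal.tendsto_atTop_zero_of_tsum_ne_top hω.ne
  have hroot := hpow.ennrpow_const (p : ℝ)⁻¹
  simp only [ENNReal.rpow_rpow_inv hp0.ne', ENNReal.zero_rpow_of_pos (inv_pos.2 hp0)] at hroot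
  exact tendsto_zero_iff_enorm_tendsto_zero.2 ((tendsto_add_atTop_iff_nat n₀).1 hroot)

end LpNorm

section EuclideanNorm

theorem norm_toLp_mulVec_le {m n : Type*} [Fintype m] [Fintype n] [DecidableEq n]
    (A : Matrix m n ℂ) (x : n → ℂ) : ‖A *ᵥ x‖₂ ≤ ‖A‖ * ‖x‖₂ :=
  A.l2_opNorm_mulVec (WithLp.toLp 2 x)

theorem l2_opNorm_le_sqrt_sum_norm_sq_col {m n : Type*} [Fintype m] [Fintype n] [DecidableEq n]
    (A : Matrix m n ℂ) : ‖A‖ ≤ √(∑ j, ‖A.col j‖₂ ^ 2) := by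
  rw [Matrix.l2_opNorm_def]
  refine ContinuousLinearMap.opNorm_le_bound _ (Real.sqrt_nonneg _) fun x => ?_
  calc ‖(Matrix.toEuclideanLin.trans LinearMap.toContinuousLinearMap) A x‖
      = ‖∑ j, x j • (WithLp.toLp 2 (A.col j) : EuclideanSpace ℂ m)‖ := by
        congr 1
        ext i
        simp [Matrix.mulVec, dotProduct, mul_comm]
    _ ≤ ∑ j, ‖x j‖ * ‖A.col j‖₂ := norm_sum_le_of_le _ fun j _ => (norm_smul _ _).le
    _ ≤ √(∑ j, ‖x j‖ ^ 2) * √(∑ j, ‖A.col j‖₂ ^ 2) := Real.sum_mul_le_sqrt_mul_sqrt _ _ _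
    _ = √(∑ j, ‖A.col j‖₂ ^ 2) * ‖x‖ := by rw [EuclideanSpace.norm_eq, mul_comm]

end EuclideanNorm

section Phase

theorem phase_add (ν : ℝ) (m n : ℤ) : phase ν (m + n) = phase ν m * phase ν n := by
  rw [phase, phase, phase, ← Complex.exp_add]
  congr 1
  push_cast
  ring

theorem phase_add_left (ν μ : ℝ) (n : ℤ) : phase (ν + μ) n = phase ν n * phase μ n := by
  rw [phase, phase, phase, ← Complex.exp_add]
  congr 1
  push_cast
  ring

theorem phase_eq_exp_I_mul_ofReal (ν : ℝ) (n : ℤ) :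
    phase ν n = Complex.exp (Complex.I * (-(2 * Real.pi * ν * n) : ℝ)) := by
  rw [phase]
  congr 1
  push_cast
  ring

theorem norm_phase (ν : ℝ) (n : ℤ) : ‖phase ν n‖ = 1 := by
  rw [phase_eq_exp_I_mul_ofReal, Complex.norm_exp_I_mul_ofReal]

theorem phase_neg (ν : ℝ) (n : ℤ) : phase ν (-n) = star (phase ν n) := by
  rw [phase_eq_exp_I_mul_ofReal, phase_eq_exp_I_mul_ofReal, Complex.star_def, ← Complex.exp_conj]
  congr 1
  simp [Complex.conj_ofNat]

theorem norm_phase_sub_phase_le (ν μ : ℝ) (n : ℤ) :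
    ‖phase ν n - phase μ n‖ ≤ 2 * Real.pi * |ν - μ| * |(n : ℝ)| := by
  have hfactor : phase ν n - phase μ n = phase μ n * (phase (ν - μ) n - 1) := by
    rw [mul_sub_one, ← phase_add_left, add_sub_cancel]
  calc ‖phase ν n - phase μ n‖ = ‖phase (ν - μ) n - 1‖ := by
        rw [hfactor, norm_mul, norm_phase, one_mul]
    _ ≤ ‖-(2 * Real.pi * (ν - μ) * n)‖ := by
        rw [phase_eq_exp_I_mul_ofReal]
        exact Real.norm_exp_I_mul_ofReal_sub_one_le
    _ = 2 * Real.pi * |ν - μ| * |(n : ℝ)| := by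
        rw [Real.norm_eq_abs, abs_neg, abs_mul, abs_mul, abs_of_pos Real.two_pi_pos]

theorem sum_phase_div_eq_zero {N : ℕ} (hN : N ≠ 0) {n : ℤ} (hn : ¬ (N : ℤ) ∣ n) :
    ∑ k ∈ Finset.range N, phase (k / N) n = 0 := by
  have hζ := Complex.isPrimitiveRoot_exp N hN
  set ζ := Complex.exp (2 * Real.pi * Complex.I / N) with hζ_def
  have hphase : ∀ k : ℕ, phase (k / N) n = (ζ ^ (-n)) ^ k := fun k => by
    rw [phase, hζ_def, ← Complex.exp_int_mul, ← Complex.exp_nat_mul]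
    congr 1
    push_cast
    ring
  have hne : ζ ^ (-n) ≠ 1 := by rwa [Ne, hζ.zpow_eq_one_iff_dvd, dvd_neg]
  have hpow : (ζ ^ (-n)) ^ N = 1 := by
    rw [← zpow_natCast, ← zpow_mul, hζ.zpow_eq_one_iff_dvd]
    exact dvd_mul_left _ _
  simp_rw [hphase]
  rw [geom_sum_eq hne, hpow, sub_self, zero_div]

theorem sum_phase_mul_star_phase {N m n : ℕ} (hm : m < N) (hn : n < N) (θ : ℝ) :
    ∑ k ∈ Finset.range N, phase (θ + k / N) n * star (phase (θ + k / N) m) =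
      if m = n then (N : ℂ) else 0 := by
  have hterm : ∀ k : ℕ, phase (θ + k / N) n * star (phase (θ + k / N) m) =
      phase θ (n - m) * phase (k / N) (n - m) := fun k => by
    rw [← phase_neg, ← phase_add, ← phase_add_left, sub_eq_add_neg]
  simp_rw [hterm]
  split_ifs with hmn
  · simp [hmn, phase]
  · rw [← Finset.mul_sum, sum_phase_div_eq_zero (by omega), mul_zero]
    intro hdvd
    have := Int.eq_zero_of_abs_lt_dvd hdvd (by rw [abs_lt]; omega)
    omega

theorem sum_norm_sq_sum_phase_mul (N : ℕ) (θ : ℝ) (y : ℕ → ℂ) :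
    ∑ k ∈ Finset.range N, ‖∑ n ∈ Finset.range N, phase (θ + k / N) n * y n‖ ^ 2 =
      N * ∑ n ∈ Finset.range N, ‖y n‖ ^ 2 := by
  have hsq : ∀ z : ℂ, ((‖z‖ ^ 2 : ℝ) : ℂ) = z * star z := fun z => by
    rw [Complex.star_def, Complex.mul_conj, Complex.normSq_eq_norm_sq]
  apply Complex.ofReal_injective
  rw [Complex.ofReal_mul, Complex.ofReal_sum, Complex.ofReal_sum, Complex.ofReal_natCast]
  simp_rw [hsq]
  calc ∑ k ∈ Finset.range N, (∑ n ∈ Finset.range N, phase (θ + k / N) n * y n) *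
        star (∑ n ∈ Finset.range N, phase (θ + k / N) n * y n)
      = ∑ k ∈ Finset.range N, ∑ n ∈ Finset.range N, ∑ m ∈ Finset.range N, y n * star (y m) *
          (phase (θ + k / N) n * star (phase (θ + k / N) m)) := by
        simp_rw [star_sum, Finset.sum_mul_sum, star_mul']
        exact Finset.sum_congr rfl fun k _ => Finset.sum_congr rfl fun n _ =>
          Finset.sum_congr rfl fun m _ => by ring
    _ = ∑ n ∈ Finset.range N, ∑ m ∈ Finset.range N, y n * star (y m) *
          ∑ k ∈ Finset.range N, phase (θ + k / N) n * star (phase (θ + k / N) m) := by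
        simp_rw [Finset.mul_sum]
        rw [Finset.sum_comm]
        exact Finset.sum_congr rfl fun n _ => Finset.sum_comm
    _ = ∑ n ∈ Finset.range N, ∑ m ∈ Finset.range N,
          y n * star (y m) * if m = n then (N : ℂ) else 0 :=
        Finset.sum_congr rfl fun n hn => Finset.sum_congr rfl fun m hm => by
          rw [sum_phase_mul_star_phase (Finset.mem_range.1 hm) (Finset.mem_range.1 hn)]
    _ = N * ∑ n ∈ Finset.range N, y n * star (y n) := by
        rw [Finset.mul_sum]
        refine Finset.sum_congr rfl fun n hn => ?_
        simp only [mul_ite, mul_zero, Finset.sum_ite_eq', if_pos hn]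
        ring

end Phase

section SmoothedFourier

variable {d d' N B : ℕ}

/-- The frequency `ν + b / N`, `b = j - B / 2`, at which column `j` of `smoothedFourier N B x ν`
samples the Fourier transform. -/
noncomputable def bandFrequency (N B : ℕ) (ν : ℝ) (j : Fin (B + 1)) : ℝ :=
  ν + ((j : ℝ) - (B : ℝ) / 2) / N

/-- The matrix `(B + 1)^{-1/2} [y_0, …, y_B]` with given columns, through which
`smoothedFourier` is assembled from its frequency samples. -/
noncomputable def normalizedColumns (y : Fin (B + 1) → Fin d → ℂ) :
    Matrix (Fin d) (Fin (B + 1)) ℂ :=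
  Matrix.of fun i j => ((√((B : ℝ) + 1) : ℝ) : ℂ)⁻¹ * y j i

theorem smoothedFourier_eq_normalizedColumns (x : ℤ → Fin d → ℂ) (ν : ℝ) :
    smoothedFourier N B x ν =
      normalizedColumns fun j => finiteFourier N x (bandFrequency N B ν j) :=
  rfl

theorem normalizedColumns_add (y z : Fin (B + 1) → Fin d → ℂ) :
    normalizedColumns (y + z) = normalizedColumns y + normalizedColumns z := by
  ext i j
  simp [normalizedColumns, mul_add]

theorem normalizedColumns_sub (y z : Fin (B + 1) → Fin d → ℂ) :
    normalizedColumns (y - z) = normalizedColumns y - normalizedColumns z := by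
  ext i j
  simp [normalizedColumns, mul_sub]

theorem mul_normalizedColumns (A : Matrix (Fin d') (Fin d) ℂ) (y : Fin (B + 1) → Fin d → ℂ) :
    A * normalizedColumns y = normalizedColumns fun j => A *ᵥ y j := by
  ext i j
  simp [normalizedColumns, Matrix.mul_apply, Matrix.mulVec, dotProduct, Finset.mul_sum,
    mul_left_comm]

theorem norm_normalizedColumns_le_sqrt (y : Fin (B + 1) → Fin d → ℂ) :
    ‖normalizedColumns y‖ ≤ √((∑ j, ‖y j‖₂ ^ 2) / (B + 1)) := by
  refine (l2_opNorm_le_sqrt_sum_norm_sq_col _).trans_eq ?_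
  have hcol : ∀ j, ‖(normalizedColumns y).col j‖₂ ^ 2 = ‖y j‖₂ ^ 2 / (B + 1) := fun j => by
    change ‖((√((B : ℝ) + 1) : ℝ) : ℂ)⁻¹ • y j‖₂ ^ 2 = _
    rw [WithLp.toLp_smul, norm_smul, mul_pow, norm_inv, Complex.norm_real, inv_pow,
      Real.norm_eq_abs, sq_abs, Real.sq_sqrt (by positivity), inv_mul_eq_div]
  rw [Finset.sum_div]
  simp_rw [hcol]

theorem norm_normalizedColumns_le {y : Fin (B + 1) → Fin d → ℂ} {r : ℝ} (hy : ∀ j, ‖y j‖₂ ≤ r) :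
    ‖normalizedColumns y‖ ≤ r := by
  have hr : 0 ≤ r := (norm_nonneg _).trans (hy 0)
  refine (norm_normalizedColumns_le_sqrt y).trans (Real.sqrt_le_iff.2 ⟨hr, ?_⟩)
  rw [div_le_iff₀ (by positivity)]
  calc ∑ j, ‖y j‖₂ ^ 2 ≤ ∑ _j : Fin (B + 1), r ^ 2 := by
        gcongr with j
        exact hy j
    _ = r ^ 2 * (B + 1) := by simp [mul_comm]

theorem abs_bandFrequency_sub_le (ν : ℝ) (j : Fin (B + 1)) :
    |bandFrequency N B ν j - ν| ≤ B / (2 * N) := by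
  have hj : (j : ℝ) ≤ B := by exact_mod_cast Nat.lt_succ_iff.1 j.2
  rw [bandFrequency, add_sub_cancel_left, abs_div, Nat.abs_cast, ← div_div]
  gcongr
  rw [abs_le]
  constructor <;> linarith [Nat.cast_nonneg (α := ℝ) (j : ℕ)]

/-- At most `N` consecutive frequencies are sampled, so this is part of Parseval's sum. -/
theorem sum_norm_sq_finiteFourier_bandFrequency_le (hB : B + 1 ≤ N) (x : ℤ → Fin d → ℂ) (ν : ℝ) :
    ∑ j, ‖finiteFourier N x (bandFrequency N B ν j)‖₂ ^ 2 ≤ ∑ n ∈ Finset.range N, ‖x n‖₂ ^ 2 := by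
  have hN : (N : ℝ) ≠ 0 := by
    norm_cast
    omega
  simp_rw [EuclideanSpace.norm_sq_eq]
  rw [Finset.sum_comm, Finset.sum_comm (s := Finset.range N)]
  refine Finset.sum_le_sum fun i _ => ?_
  set θ := ν - B / 2 / N with hθ
  have hsample : ∀ j : Fin (B + 1), ‖finiteFourier N x (bandFrequency N B ν j) i‖ ^ 2 =
      (N : ℝ)⁻¹ * ‖∑ n ∈ Finset.range N, phase (θ + j / N) n * x n i‖ ^ 2 := fun j => by
    have : bandFrequency N B ν j = θ + j / N := by rw [bandFrequency, hθ]; ring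
    rw [this, finiteFourier, Pi.smul_apply, Finset.sum_apply, norm_smul, mul_pow, norm_inv,
      Complex.norm_real, inv_pow, Real.norm_eq_abs, sq_abs, Real.sq_sqrt (Nat.cast_nonneg _)]
    simp only [Pi.smul_apply, smul_eq_mul]
  calc ∑ j : Fin (B + 1), ‖finiteFourier N x (bandFrequency N B ν j) i‖ ^ 2
      = ∑ j ∈ Finset.range (B + 1),
          (N : ℝ)⁻¹ * ‖∑ n ∈ Finset.range N, phase (θ + j / N) n * x n i‖ ^ 2 := by
        rw [Finset.sum_congr rfl fun j _ => hsample j, Finset.sum_range]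
    _ ≤ ∑ k ∈ Finset.range N,
          (N : ℝ)⁻¹ * ‖∑ n ∈ Finset.range N, phase (θ + k / N) n * x n i‖ ^ 2 :=
        Finset.sum_le_sum_of_subset_of_nonneg (Finset.range_mono hB) fun _ _ _ => by positivity
    _ = ∑ n ∈ Finset.range N, ‖x n i‖ ^ 2 := by
        rw [← Finset.mul_sum, sum_norm_sq_sum_phase_mul N θ fun n => x n i,
          inv_mul_cancel_left₀ hN]

end SmoothedFourier

section Window

/-- The indices lying in exactly one of the windows `[-k, N - k)` and `[0, N)`: these are the terms
that survive when a sum over `0 ≤ n < N` is compared with its shift by `k`. -/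
noncomputable def edgeIndices (N : ℕ) (k : ℤ) : Finset ℤ :=
  symmDiff (Finset.Ico (-k) (N - k)) (Finset.Ico 0 (N : ℤ))

theorem card_edgeIndices_le (N : ℕ) (k : ℤ) : ((edgeIndices N k).card : ℝ) ≤ 2 * |(k : ℝ)| := by
  have hsubset : edgeIndices N k ⊆ Finset.Ico (min 0 (-k)) (max 0 (-k)) ∪
      Finset.Ico (min (N : ℤ) (N - k)) (max (N : ℤ) (N - k)) := by
    intro j hj
    simp only [edgeIndices, Finset.mem_symmDiff, Finset.mem_union, Finset.mem_Ico] at hj ⊢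
    omega
  have hcard := (Finset.card_le_card hsubset).trans (Finset.card_union_le _ _)
  rw [Int.card_Ico, Int.card_Ico] at hcard
  have hcard' : ((edgeIndices N k).card : ℤ) ≤ 2 * |k| := by
    rcases abs_cases k with hk | hk <;> omega
  exact_mod_cast hcard'

theorem sum_range_intCast_sub {E : Type*} [AddCommMonoid E] (N : ℕ) (g : ℤ → E) (k : ℤ) :
    ∑ n ∈ Finset.range N, g (n - k) = ∑ j ∈ Finset.Ico (-k) (N - k), g j := by
  refine Finset.sum_nbij (fun n : ℕ => (n : ℤ) - k) ?_ ?_ ?_ fun _ _ => rfl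
  · intro n hn
    simp only [Finset.mem_range, Finset.mem_Ico] at hn ⊢
    omega
  · intro a _ b _ hab
    simpa using hab
  · intro j hj
    simp only [Finset.coe_Ico, Set.mem_Ico] at hj
    exact ⟨(j + k).toNat, by simp only [Finset.coe_range, Set.mem_Iio]; omega,
      by simp only; omega⟩

theorem sum_range_intCast {E : Type*} [AddCommMonoid E] (N : ℕ) (g : ℤ → E) :
    ∑ n ∈ Finset.range N, g n = ∑ j ∈ Finset.Ico 0 (N : ℤ), g j := by
  simpa only [sub_zero, neg_zero] using sum_range_intCast_sub N g 0

theorem sum_edgeIndices {E : Type*} [AddCommMonoid E] (N : ℕ) (g : ℤ → E) (k : ℤ) :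
    ∑ j ∈ edgeIndices N k, g j =
      ∑ j ∈ Finset.Ico (-k) (N - k) \ Finset.Ico 0 (N : ℤ), g j +
        ∑ j ∈ Finset.Ico 0 (N : ℤ) \ Finset.Ico (-k) (N - k), g j :=
  Finset.sum_union disjoint_sdiff_sdiff

theorem sum_edgeIndices_le (N : ℕ) {g : ℤ → ℝ} (hg : ∀ n, 0 ≤ g n) (k : ℤ) :
    ∑ j ∈ edgeIndices N k, g j ≤
      ∑ n ∈ Finset.range N, g (n - k) + ∑ n ∈ Finset.range N, g n := by
  rw [sum_edgeIndices, sum_range_intCast_sub, sum_range_intCast]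
  exact add_le_add
    (Finset.sum_le_sum_of_subset_of_nonneg Finset.sdiff_subset fun _ _ _ => hg _)
    (Finset.sum_le_sum_of_subset_of_nonneg Finset.sdiff_subset fun _ _ _ => hg _)

theorem norm_sum_shift_sub_le {E : Type*} [SeminormedAddCommGroup E] (N : ℕ) (g : ℤ → E) (k : ℤ) :
    ‖∑ n ∈ Finset.range N, (g (n - k) - g n)‖ ≤ ∑ j ∈ edgeIndices N k, ‖g j‖ := by
  rw [Finset.sum_sub_distrib, sum_range_intCast_sub, sum_range_intCast,
    ← Finset.sum_sdiff_sub_sum_sdiff, sum_edgeIndices]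
  exact (norm_sub_le _ _).trans (add_le_add (norm_sum_le _ _) (norm_sum_le _ _))

end Window

section Filtering

variable {d K : ℕ} {H : ℤ → Matrix (Fin d) (Fin K) ℂ} {e : ℤ → Fin K → ℂ} {v : ℤ → Fin d → ℂ}
  {C : ℝ}

/-- The memory condition `∑_k (1 + |k|) ‖H_k‖ ≤ C` on a single filter. -/
structure HasMemoryBound (H : ℤ → Matrix (Fin d) (Fin K) ℂ) (C : ℝ) : Prop where
  summable : Summable fun k : ℤ => (1 + |(k : ℝ)|) * ‖H k‖
  tsum_le : ∑' k : ℤ, (1 + |(k : ℝ)|) * ‖H k‖ ≤ C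

theorem HasMemoryBound.nonneg (hH : HasMemoryBound H C) : 0 ≤ C :=
  (tsum_nonneg fun _ => by positivity).trans hH.tsum_le

theorem HasMemoryBound.summable_norm (hH : HasMemoryBound H C) : Summable fun k => ‖H k‖ :=
  hH.summable.of_nonneg_of_le (fun _ => norm_nonneg _) fun _ =>
    le_mul_of_one_le_left (norm_nonneg _) (le_add_of_nonneg_right (abs_nonneg _))

theorem hasSum_transferFunction (hs : Summable fun k => ‖H k‖) (ν : ℝ) :
    HasSum (fun k => phase ν k • H k) (transferFunction H ν) := by
  have : CompleteSpace (Matrix (Fin d) (Fin K) ℂ) := FiniteDimensional.complete ℂ _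
  refine (Summable.of_norm ?_).hasSum
  simpa only [norm_smul, norm_phase, one_mul] using hs

theorem HasMemoryBound.norm_transferFunction_sub_le (hH : HasMemoryBound H C) (ν μ : ℝ) :
    ‖transferFunction H ν - transferFunction H μ‖ ≤ 2 * Real.pi * |ν - μ| * C := by
  have hsub := (hasSum_transferFunction hH.summable_norm ν).sub
    (hasSum_transferFunction hH.summable_norm μ)
  calc ‖transferFunction H ν - transferFunction H μ‖
      ≤ 2 * Real.pi * |ν - μ| * ∑' k : ℤ, (1 + |(k : ℝ)|) * ‖H k‖ := by
        refine hsub.norm_le_of_bounded (hH.summable.hasSum.mul_left _) fun _ => ?_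
        rw [← sub_smul, norm_smul, ← mul_assoc]
        gcongr
        refine (norm_phase_sub_phase_le ν μ _).trans ?_
        gcongr
        linarith
    _ ≤ 2 * Real.pi * |ν - μ| * C := by
        gcongr
        exact hH.tsum_le

/-- The contribution of the edge indices to the filtered sequence: up to the factor `N^{-1/2}`, it
bounds `ξ_v(ν) - H(ν) ξ_e(ν)` when `v` is `e` filtered by `H`. -/
noncomputable def edgeEffect (H : ℤ → Matrix (Fin d) (Fin K) ℂ) (N : ℕ) (e : ℤ → Fin K → ℂ) : ℝ :=
  ∑' k, ‖H k‖ * ∑ j ∈ edgeIndices N k, ‖e j‖₂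

theorem edgeEffect_nonneg (N : ℕ) : 0 ≤ edgeEffect H N e :=
  tsum_nonneg fun _ => by positivity

theorem summable_edgeEffect (hs : Summable fun k => ‖H k‖)
    (he : ∀ n, Summable fun k => ‖H k‖ * ‖e (n - k)‖₂) (N : ℕ) :
    Summable fun k => ‖H k‖ * ∑ j ∈ edgeIndices N k, ‖e j‖₂ := by
  have hshift : Summable fun k => ∑ n ∈ Finset.range N, ‖H k‖ * ‖e (n - k)‖₂ :=
    summable_sum fun (n : ℕ) _ => he n
  have hwindow : Summable fun k => ‖H k‖ * ∑ n ∈ Finset.range N, ‖e n‖₂ := hs.mul_right _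
  refine (hshift.add hwindow).of_nonneg_of_le (fun k => by positivity) fun k => ?_
  rw [← Finset.mul_sum, ← mul_add]
  gcongr
  exact sum_edgeIndices_le N (fun n => norm_nonneg (WithLp.toLp 2 (e n))) k

theorem hasSum_mulVec_of_summable (he : ∀ n, Summable fun k => ‖H k‖ * ‖e (n - k)‖₂) (n : ℤ) :
    HasSum (fun k => H k *ᵥ e (n - k)) (∑' k, H k *ᵥ e (n - k)) := by
  have hsum : Summable fun k => (WithLp.toLp 2 (H k *ᵥ e (n - k)) : EuclideanSpace ℂ (Fin d)) :=
    .of_norm_bounded (he n) fun k => norm_toLp_mulVec_le _ _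
  exact (hsum.map (WithLp.linearEquiv 2 ℂ (Fin d → ℂ)) (PiLp.continuous_ofLp 2 _)).hasSum

theorem hasSum_finiteFourier_sub (hs : Summable fun k => ‖H k‖)
    (he : ∀ n, Summable fun k => ‖H k‖ * ‖e (n - k)‖₂) (hv : ∀ n, v n = ∑' k, H k *ᵥ e (n - k))
    (N : ℕ) (ν : ℝ) :
    HasSum (fun k => ((√N : ℝ) : ℂ)⁻¹ • phase ν k • H k *ᵥ
        ∑ n ∈ Finset.range N, (phase ν (n - k) • e (n - k) - phase ν n • e n))
      (finiteFourier N v ν - transferFunction H ν *ᵥ finiteFourier N e ν) := by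
  have hfilter : HasSum (fun k => ∑ n ∈ Finset.range N, phase ν n • H k *ᵥ e (n - k))
      (∑ n ∈ Finset.range N, phase ν n • v n) :=
    hasSum_sum fun n _ => (hv n ▸ hasSum_mulVec_of_summable he n).const_smul _
  have htransfer : HasSum (fun k => (phase ν k • H k) *ᵥ ∑ n ∈ Finset.range N, phase ν n • e n)
      (transferFunction H ν *ᵥ ∑ n ∈ Finset.range N, phase ν n • e n) :=
    (hasSum_transferFunction hs ν).map
      (Matrix.mulVec.addMonoidHomLeft (∑ n ∈ Finset.range N, phase ν n • e n))
      (continuous_id.matrix_mulVec continuous_const)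
  have hterm : ∀ k, ((√N : ℝ) : ℂ)⁻¹ • phase ν k • H k *ᵥ
        ∑ n ∈ Finset.range N, (phase ν (n - k) • e (n - k) - phase ν n • e n) =
      ((√N : ℝ) : ℂ)⁻¹ • (∑ n ∈ Finset.range N, phase ν n • H k *ᵥ e (n - k) -
        (phase ν k • H k) *ᵥ ∑ n ∈ Finset.range N, phase ν n • e n) := fun k => by
    rw [Finset.sum_sub_distrib, Matrix.mulVec_sub, smul_sub, Matrix.smul_mulVec,
      Matrix.mulVec_sum, Finset.smul_sum]
    simp_rw [Matrix.mulVec_smul, smul_smul (phase ν k), ← phase_add, add_sub_cancel]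
  rw [finiteFourier, finiteFourier, Matrix.mulVec_smul, ← smul_sub, funext hterm]
  exact (hfilter.sub htransfer).const_smul _

theorem norm_finiteFourier_sub_le (hs : Summable fun k => ‖H k‖)
    (he : ∀ n, Summable fun k => ‖H k‖ * ‖e (n - k)‖₂) (hv : ∀ n, v n = ∑' k, H k *ᵥ e (n - k))
    (N : ℕ) (ν : ℝ) :
    ‖finiteFourier N v ν - transferFunction H ν *ᵥ finiteFourier N e ν‖₂ ≤
      (√N)⁻¹ * edgeEffect H N e := by
  have hsum := (hasSum_finiteFourier_sub hs he hv N ν).map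
    (WithLp.linearEquiv 2 ℂ (Fin d → ℂ)).symm (PiLp.continuous_toLp 2 _)
  refine hsum.norm_le_of_bounded ((summable_edgeEffect hs he N).hasSum.mul_left _) fun k => ?_
  have hedge : ‖∑ n ∈ Finset.range N, (phase ν (n - k) • e (n - k) - phase ν n • e n)‖₂ ≤
      ∑ j ∈ edgeIndices N k, ‖e j‖₂ := by
    have h := norm_sum_shift_sub_le N
      (fun n => (WithLp.toLp 2 (phase ν n • e n) : EuclideanSpace ℂ (Fin K))) k
    simpa only [WithLp.toLp_sum, WithLp.toLp_sub, WithLp.toLp_smul, norm_smul, norm_phase,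
      one_mul] using h
  simp only [Function.comp_apply, map_smul, norm_smul, norm_phase, one_mul, norm_inv,
    Complex.norm_real, Real.norm_eq_abs, abs_of_nonneg (Real.sqrt_nonneg _)]
  gcongr
  exact (norm_toLp_mulVec_le _ _).trans (mul_le_mul_of_nonneg_left hedge (norm_nonneg _))

end Filtering

section ErrorBound

variable {d K N B : ℕ} {H : ℤ → Matrix (Fin d) (Fin K) ℂ} {C : ℝ}

/-- The pathwise bound of the factorization error at all frequencies, when `e` is the input of a
filter with memory bound `C` and `B + 1 ≤ N`. -/
noncomputable def factorizationBound (H : ℤ → Matrix (Fin d) (Fin K) ℂ) (C : ℝ) (N B : ℕ)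
    (e : ℤ → Fin K → ℂ) : ℝ :=
  √((B + 1) / N) *
    (edgeEffect H N e + Real.pi * C * √((∑ n ∈ Finset.range N, ‖e n‖₂ ^ 2) / N))

theorem HasMemoryBound.norm_normalizedColumns_sub_mulVec_le (hH : HasMemoryBound H C)
    (hB : B + 1 ≤ N) (e : ℤ → Fin K → ℂ) (ν : ℝ) :
    ‖normalizedColumns fun j => (transferFunction H (bandFrequency N B ν j) -
        transferFunction H ν) *ᵥ finiteFourier N e (bandFrequency N B ν j)‖ ≤
      √((B + 1) / N) * (Real.pi * C * √((∑ n ∈ Finset.range N, ‖e n‖₂ ^ 2) / N)) := by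
  have hC := hH.nonneg
  have hN : (0 : ℝ) < N := by
    norm_cast
    omega
  set S := ∑ n ∈ Finset.range N, ‖e n‖₂ ^ 2
  set r := Real.pi * C * ((B + 1) / N)
  have hcol : ∀ j, ‖(transferFunction H (bandFrequency N B ν j) - transferFunction H ν) *ᵥ
      finiteFourier N e (bandFrequency N B ν j)‖₂ ≤
        r * ‖finiteFourier N e (bandFrequency N B ν j)‖₂ := fun j => by
    refine (norm_toLp_mulVec_le _ _).trans ?_
    gcongr
    calc _ ≤ 2 * Real.pi * |bandFrequency N B ν j - ν| * C := hH.norm_transferFunction_sub_le _ _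
      _ ≤ 2 * Real.pi * ((B + 1) / (2 * N)) * C := by
        gcongr
        refine (abs_bandFrequency_sub_le ν j).trans ?_
        gcongr
        linarith
      _ = r := by simp only [r]; field_simp
  have hsum : ∑ j, ‖(transferFunction H (bandFrequency N B ν j) - transferFunction H ν) *ᵥ
      finiteFourier N e (bandFrequency N B ν j)‖₂ ^ 2 ≤ r ^ 2 * S := by
    calc _ ≤ ∑ j, r ^ 2 * ‖finiteFourier N e (bandFrequency N B ν j)‖₂ ^ 2 := by
          gcongr with j
          rw [← mul_pow]
          gcongr
          exact hcol j
      _ ≤ r ^ 2 * S := by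
          rw [← Finset.mul_sum]
          gcongr
          exact sum_norm_sq_finiteFourier_bandFrequency_le hB e ν
  calc _ ≤ √(r ^ 2 * S / (B + 1)) :=
        (norm_normalizedColumns_le_sqrt _).trans (Real.sqrt_le_sqrt (by gcongr))
    _ = √((Real.pi * C) ^ 2 * ((B + 1) / N * (S / N))) := by
        congr 1
        simp only [r]
        field_simp
    _ = _ := by
        rw [Real.sqrt_mul (by positivity), Real.sqrt_sq (by positivity),
          Real.sqrt_mul (by positivity)]
        ring

theorem HasMemoryBound.norm_smoothedFourier_sub_le (hH : HasMemoryBound H C) {e : ℤ → Fin K → ℂ}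
    {v : ℤ → Fin d → ℂ} (he : ∀ n, Summable fun k => ‖H k‖ * ‖e (n - k)‖₂)
    (hv : ∀ n, v n = ∑' k, H k *ᵥ e (n - k)) (hB : B + 1 ≤ N) (ν : ℝ) :
    ‖smoothedFourier N B v ν - transferFunction H ν * smoothedFourier N B e ν‖ ≤
      factorizationBound H C N B e := by
  set f := bandFrequency N B ν
  have hsplit : smoothedFourier N B v ν - transferFunction H ν * smoothedFourier N B e ν =
      normalizedColumns (fun j => finiteFourier N v (f j) -
          transferFunction H (f j) *ᵥ finiteFourier N e (f j)) +
        normalizedColumns fun j => (transferFunction H (f j) - transferFunction H ν) *ᵥ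
          finiteFourier N e (f j) := by
    rw [smoothedFourier_eq_normalizedColumns, smoothedFourier_eq_normalizedColumns,
      mul_normalizedColumns, ← normalizedColumns_sub, ← normalizedColumns_add]
    congr 1
    funext j
    simp only [Pi.sub_apply, Pi.add_apply, Matrix.sub_mulVec, sub_add_sub_cancel, f]
  have hedge : ‖normalizedColumns fun j => finiteFourier N v (f j) -
      transferFunction H (f j) *ᵥ finiteFourier N e (f j)‖ ≤
        √((B + 1) / N) * edgeEffect H N e := by
    refine (norm_normalizedColumns_le fun j =>
      norm_finiteFourier_sub_le hH.summable_norm he hv N (f j)).trans ?_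
    have := edgeEffect_nonneg (H := H) (e := e) N
    rw [← Real.sqrt_inv, ← one_div]
    gcongr
    linarith [(B.cast_nonneg : (0 : ℝ) ≤ B)]
  rw [hsplit, factorizationBound, mul_add]
  exact (norm_add_le _ _).trans
    (add_le_add hedge (hH.norm_normalizedColumns_sub_mulVec_le hB e ν))

end ErrorBound

section Moments

variable {Ω : Type*} [MeasurableSpace Ω] {P : Measure Ω} {d K : ℕ}
  {H : ℤ → Matrix (Fin d) (Fin K) ℂ} {C : ℝ} {ε : ℤ → Ω → Fin K → ℂ} {p m : ℝ≥0}

theorem aestronglyMeasurable_norm_toLp {x : Ω → Fin K → ℂ} (hx : AEStronglyMeasurable x P) :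
    AEStronglyMeasurable (fun ω => ‖x ω‖₂) P :=
  (PiLp.continuous_toLp 2 _).norm.comp_aestronglyMeasurable hx

theorem eLpNorm_mul_norm_toLp_le (a : ℝ) {s : Finset ℤ} (hp : 1 ≤ p)
    (hε : ∀ n, AEStronglyMeasurable (ε n) P) (hm : ∀ n, eLpNorm (fun ω => ‖ε n ω‖₂) p P ≤ m) :
    eLpNorm (fun ω => a * ∑ j ∈ s, ‖ε j ω‖₂) p P ≤ ‖a‖ₑ * (s.card * m) := by
  have hsum : eLpNorm (∑ j ∈ s, fun ω => ‖ε j ω‖₂) p P ≤ s.card * m := by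
    refine (eLpNorm_sum_le (fun j _ => aestronglyMeasurable_norm_toLp (hε j))
      (by exact_mod_cast hp)).trans ?_
    rw [← nsmul_eq_mul]
    exact Finset.sum_le_card_nsmul _ _ _ fun j _ => hm j
  calc _ = ‖a‖ₑ * eLpNorm (∑ j ∈ s, fun ω => ‖ε j ω‖₂) p P := by
        rw [← eLpNorm_const_smul]
        congr 1
        ext ω
        simp
    _ ≤ ‖a‖ₑ * (s.card * m) := by gcongr

theorem HasMemoryBound.ae_summable_norm_mul (hH : HasMemoryBound H C) (hp : 1 ≤ p)
    (hε : ∀ n, AEStronglyMeasurable (ε n) P) (hm : ∀ n, eLpNorm (fun ω => ‖ε n ω‖₂) p P ≤ m) :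
    ∀ᵐ ω ∂P, ∀ n, Summable fun k => ‖H k‖ * ‖ε (n - k) ω‖₂ := by
  refine ae_all_iff.2 fun n => ?_
  have hterm : ∀ k, eLpNorm (fun ω => ‖H k‖ * ‖ε (n - k) ω‖₂) p P ≤ ‖H k‖ₑ * m := fun k => by
    simpa using eLpNorm_mul_norm_toLp_le ‖H k‖ (s := {n - k}) hp hε hm
  have hfin : ∑' k, eLpNorm (fun ω => ‖H k‖ * ‖ε (n - k) ω‖₂) p P ≠ ∞ := by
    refine ne_top_of_le_ne_top ?_ (ENNReal.tsum_le_tsum hterm)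
    rw [ENNReal.tsum_mul_right]
    exact ENNReal.mul_ne_top (tsum_enorm_ne_top_iff_summable_norm.2 hH.summable_norm)
      ENNReal.coe_ne_top
  filter_upwards [summable_norm_of_tsum_eLpNorm_ne_top (by exact_mod_cast hp)
    (fun k => (aestronglyMeasurable_norm_toLp (hε (n - k))).const_mul ‖H k‖) hfin] with ω hω
  exact hω.of_norm

theorem aestronglyMeasurable_edgeEffect (hε : ∀ n, AEStronglyMeasurable (ε n) P) (N : ℕ) :
    AEStronglyMeasurable (fun ω => edgeEffect H N fun n => ε n ω) P := by
  have hterm : ∀ j, AEMeasurable (fun ω => ‖ε j ω‖₂.toNNReal) P := fun j =>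
    (aestronglyMeasurable_norm_toLp (hε j)).aemeasurable.real_toNNReal
  have hsum : AEMeasurable
      (fun ω => ∑' k, ‖H k‖₊ * ∑ j ∈ edgeIndices N k, ‖ε j ω‖₂.toNNReal) P :=
    AEMeasurable.tsum fun k => (Finset.aemeasurable_fun_sum _ fun j _ => hterm j).const_mul _
  refine (hsum.coe_nnreal_real.congr (.of_forall fun ω => ?_)).aestronglyMeasurable
  simp [edgeEffect, NNReal.coe_tsum]

theorem HasMemoryBound.eLpNorm_edgeEffect_le (hH : HasMemoryBound H C) (hp : 1 ≤ p)
    (hε : ∀ n, AEStronglyMeasurable (ε n) P) (hm : ∀ n, eLpNorm (fun ω => ‖ε n ω‖₂) p P ≤ m)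
    (N : ℕ) :
    eLpNorm (fun ω => edgeEffect H N fun n => ε n ω) p P ≤ ENNReal.ofReal (2 * C) * m := by
  have hmeas : ∀ k, AEStronglyMeasurable
      (fun ω => ‖H k‖ * ∑ j ∈ edgeIndices N k, ‖ε j ω‖₂) P := fun k =>
    (Finset.aestronglyMeasurable_fun_sum _ fun j _ =>
      aestronglyMeasurable_norm_toLp (hε j)).const_mul _
  have hweight : ∀ k, ‖H k‖ₑ * (edgeIndices N k).card ≤
      ENNReal.ofReal (2 * ((1 + |(k : ℝ)|) * ‖H k‖)) := fun k => by
    rw [← ofReal_norm, ← ENNReal.ofReal_natCast, ← ENNReal.ofReal_mul (norm_nonneg _)]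
    refine ENNReal.ofReal_le_ofReal ?_
    rw [mul_comm ‖H k‖, ← mul_assoc]
    gcongr
    linarith [card_edgeIndices_le N k]
  calc _ ≤ ∑' k, eLpNorm (fun ω => ‖H k‖ * ∑ j ∈ edgeIndices N k, ‖ε j ω‖₂) p P :=
        eLpNorm_tsum_le (by exact_mod_cast hp) hmeas
    _ ≤ ∑' k : ℤ, ENNReal.ofReal (2 * ((1 + |(k : ℝ)|) * ‖H k‖)) * m := by
        refine ENNReal.tsum_le_tsum fun k =>
          (eLpNorm_mul_norm_toLp_le ‖H k‖ hp hε hm).trans ?_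
        rw [enorm_norm, ← mul_assoc]
        gcongr
        exact hweight k
    _ = ENNReal.ofReal (2 * ∑' k : ℤ, (1 + |(k : ℝ)|) * ‖H k‖) * m := by
        rw [ENNReal.tsum_mul_right, ← tsum_mul_left,
          ENNReal.ofReal_tsum_of_nonneg (fun k => by positivity) (hH.summable.mul_left 2)]
    _ ≤ ENNReal.ofReal (2 * C) * m := by
        gcongr
        exact hH.tsum_le

theorem aestronglyMeasurable_sqrt_mean_sq (hε : ∀ n, AEStronglyMeasurable (ε n) P) (N : ℕ) :
    AEStronglyMeasurable (fun ω => √((∑ n ∈ Finset.range N, ‖ε n ω‖₂ ^ 2) / N)) P := by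
  have hsum : AEStronglyMeasurable (fun ω => ∑ n ∈ Finset.range N, ‖ε n ω‖₂ ^ 2) P :=
    Finset.aestronglyMeasurable_fun_sum _ fun n _ => (aestronglyMeasurable_norm_toLp (hε n)).pow 2
  have hmean : AEStronglyMeasurable (fun ω => (∑ n ∈ Finset.range N, ‖ε n ω‖₂ ^ 2) / N) P := by
    simpa only [div_eq_mul_inv] using hsum.mul_const _
  exact Real.continuous_sqrt.comp_aestronglyMeasurable hmean

theorem aestronglyMeasurable_factorizationBound (hε : ∀ n, AEStronglyMeasurable (ε n) P)
    (N B : ℕ) :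
    AEStronglyMeasurable (fun ω => factorizationBound H C N B fun n => ε n ω) P :=
  ((aestronglyMeasurable_edgeEffect hε N).add
    ((aestronglyMeasurable_sqrt_mean_sq hε N).const_mul _)).const_mul _

theorem HasMemoryBound.eLpNorm_factorizationBound_le (hH : HasMemoryBound H C) (hp : 2 ≤ p)
    (hε : ∀ n, AEStronglyMeasurable (ε n) P) (hm : ∀ n, eLpNorm (fun ω => ‖ε n ω‖₂) p P ≤ m)
    (N B : ℕ) :
    eLpNorm (fun ω => factorizationBound H C N B fun n => ε n ω) p P ≤
      ENNReal.ofReal √((B + 1) / N) * (ENNReal.ofReal ((2 + Real.pi) * C) * m) := by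
  have hC := hH.nonneg
  have hp1 : 1 ≤ p := one_le_two.trans hp
  set edge : Ω → ℝ := fun ω => edgeEffect H N fun n => ε n ω
  set mean : Ω → ℝ := fun ω => √((∑ n ∈ Finset.range N, ‖ε n ω‖₂ ^ 2) / N)
  have hmean : eLpNorm mean p P ≤ m := by
    simpa [mean] using eLpNorm_sqrt_mean_sq_le (Finset.range N) hp
      (fun n : ℕ => aestronglyMeasurable_norm_toLp (hε n)) fun n => hm n
  calc _ = ENNReal.ofReal √((B + 1) / N) * eLpNorm (edge + (Real.pi * C) • mean) p P := by
        rw [← Real.enorm_eq_ofReal (Real.sqrt_nonneg _), ← eLpNorm_const_smul]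
        rfl
    _ ≤ ENNReal.ofReal √((B + 1) / N) *
        (ENNReal.ofReal (2 * C) * m + ENNReal.ofReal (Real.pi * C) * m) := by
        gcongr
        refine (eLpNorm_add_le (aestronglyMeasurable_edgeEffect hε N)
          ((aestronglyMeasurable_sqrt_mean_sq hε N).const_smul _)
          (by exact_mod_cast hp1)).trans ?_
        rw [eLpNorm_const_smul, Real.enorm_eq_ofReal (by positivity)]
        gcongr
        exact hH.eLpNorm_edgeEffect_le hp1 hε hm N
    _ = ENNReal.ofReal √((B + 1) / N) * (ENNReal.ofReal ((2 + Real.pi) * C) * m) := by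
        rw [← add_mul, ← ENNReal.ofReal_add (by positivity) (by positivity), ← add_mul]

end Moments

section Gaussian

theorem isGaussian_complexGaussian (v : ℝ≥0) : IsGaussian (complexGaussian v) :=
  isGaussian_map_equiv (μ := (gaussianReal 0 (v / 2)).prod (gaussianReal 0 (v / 2)))
    Complex.equivRealProdCLM.symm

variable {Ω : Type*} [MeasurableSpace Ω] {P : Measure Ω} {K : ℕ}

theorem IsComplexGaussianVector.hasLaw_apply {x : Ω → Fin K → ℂ}
    (hx : IsComplexGaussianVector x 1 P) (i : Fin K) :
    HasLaw (fun ω => x ω i) (complexGaussian 1) P := by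
  simpa using hx (Pi.single i 1)

theorem IsComplexGaussianVector.eLpNorm_le {x : Ω → Fin K → ℂ}
    (hx : IsComplexGaussianVector x 1 P) {p : ℝ≥0∞} (hp : 1 ≤ p) :
    eLpNorm (fun ω => ‖x ω‖₂) p P ≤ K * eLpNorm id p (complexGaussian 1) := by
  have hcoord : ∀ i, eLpNorm (fun ω => ‖x ω i‖) p P = eLpNorm id p (complexGaussian 1) :=
    fun i => by
      have hlaw := hx.hasLaw_apply i
      rw [eLpNorm_norm, ← hlaw.map_eq,
        eLpNorm_map_measure aestronglyMeasurable_id hlaw.aemeasurable]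
      rfl
  calc _ ≤ eLpNorm (∑ i, fun ω => ‖x ω i‖) p P := by
        refine eLpNorm_mono_real fun ω => ?_
        rw [norm_norm, Finset.sum_apply, EuclideanSpace.norm_eq]
        exact Real.sqrt_le_iff.2 ⟨Finset.sum_nonneg fun _ _ => norm_nonneg _,
          Finset.sum_sq_le_sq_sum_of_nonneg fun _ _ => norm_nonneg _⟩
    _ ≤ ∑ i, eLpNorm (fun ω => ‖x ω i‖) p P :=
        eLpNorm_sum_le (fun i _ => (hx.hasLaw_apply i).aemeasurable.norm.aestronglyMeasurable) hp
    _ = K * eLpNorm id p (complexGaussian 1) := by simp [hcoord]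

theorem exists_eLpNorm_le_of_isComplexGaussianVector (K : ℕ) {p : ℝ≥0} (hp : 1 ≤ p) :
    ∃ m : ℝ≥0, ∀ {Ω : Type*} [MeasurableSpace Ω] {P : Measure Ω} {x : Ω → Fin K → ℂ},
      IsComplexGaussianVector x 1 P → eLpNorm (fun ω => ‖x ω‖₂) p P ≤ m := by
  have := isGaussian_complexGaussian 1
  have hfin : K * eLpNorm id p (complexGaussian 1) ≠ ∞ :=
    ENNReal.mul_ne_top (ENNReal.natCast_ne_top K)
      (IsGaussian.memLp_id _ p ENNReal.coe_ne_top).eLpNorm_ne_top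
  refine ⟨(K * eLpNorm id p (complexGaussian 1)).toNNReal, fun hx => ?_⟩
  rw [ENNReal.coe_toNNReal hfin]
  exact hx.eLpNorm_le (by exact_mod_cast hp)

end Gaussian

section Regime

variable {N B : ℕ → ℕ}

theorem HighDimensionalRegime.eventually_pos (h : HighDimensionalRegime N B) :
    ∀ᶠ M in atTop, 0 < N M := by
  obtain ⟨α, hα, -, hO⟩ := h.sample_size
  filter_upwards [hO.eq_zero_imp, eventually_gt_atTop 0] with M hzero hM
  refine Nat.pos_of_ne_zero fun hN => hM.ne' ?_
  simpa [hN, Real.zero_rpow hα.ne'] using hzero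

theorem HighDimensionalRegime.isBigO_span (h : HighDimensionalRegime N B) :
    (fun M => (B M : ℝ) + 1) =O[atTop] fun M : ℕ => (M : ℝ) := by
  obtain ⟨c, hc, -, hlim⟩ := h.ratio
  have hB : (fun M => (B M : ℝ)) =O[atTop] fun M : ℕ => (M : ℝ) :=
    isBigO_of_div_tendsto_nhds_of_ne_zero hlim hc.ne'
  exact hB.add ((isLittleO_const_id_atTop (1 : ℝ)).comp_tendsto tendsto_natCast_atTop_atTop).isBigO

theorem HighDimensionalRegime.exists_isBigO_inv (h : HighDimensionalRegime N B) :
    ∃ δ > (0 : ℝ), (fun M => (N M : ℝ)⁻¹) =O[atTop] fun M : ℕ => (M : ℝ) ^ (-(1 + δ)) := by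
  obtain ⟨α, hα, hα1, hO⟩ := h.sample_size
  refine ⟨1 / α - 1, sub_pos.2 (one_lt_one_div hα hα1), ?_⟩
  have hpow := hO.rpow (one_div_nonneg.2 hα.le) (.of_forall fun M => by positivity)
  simp only [← Real.rpow_mul (Nat.cast_nonneg _), mul_one_div_cancel hα.ne', Real.rpow_one] at hpow
  refine (hpow.inv_rev ?_).congr_right fun M => ?_
  · filter_upwards [eventually_gt_atTop 0] with M hM hzero
    have : (0 : ℝ) < M := by exact_mod_cast hM
    exact absurd hzero (by positivity)
  · rw [add_sub_cancel, Real.rpow_neg M.cast_nonneg]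

theorem HighDimensionalRegime.exists_isBigO_ratio (h : HighDimensionalRegime N B) :
    ∃ δ > (0 : ℝ), (fun M => ((B M : ℝ) + 1) / N M) =O[atTop] fun M : ℕ => (M : ℝ) ^ (-δ) := by
  obtain ⟨δ, hδ, hinv⟩ := h.exists_isBigO_inv
  refine ⟨δ, hδ, (h.isBigO_span.mul hinv).congr' (.of_forall fun M => (div_eq_mul_inv _ _).symm) ?_⟩
  filter_upwards [eventually_gt_atTop 0] with M hM
  have hM' : (0 : ℝ) < M := by exact_mod_cast hM
  rw [← Real.rpow_one_add' hM'.le (by linarith)]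
  congr 1
  ring

theorem HighDimensionalRegime.exists_summable_rpow (h : HighDimensionalRegime N B) :
    ∃ p : ℝ≥0, 2 ≤ p ∧ Summable fun M => (((B M : ℝ) + 1) / N M) ^ (p / 2 : ℝ) := by
  obtain ⟨δ, hδ, hO⟩ := h.exists_isBigO_ratio
  obtain ⟨q, hq⟩ := exists_nat_gt (max 1 (1 / δ))
  obtain ⟨hq1, hqδ⟩ := max_lt_iff.1 hq
  refine ⟨2 * q, le_mul_of_one_le_right zero_le_two (by exact_mod_cast hq1.le), ?_⟩
  have hpow := hO.rpow q.cast_nonneg (.of_forall fun M => by positivity)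
  simp only [← Real.rpow_mul (Nat.cast_nonneg _)] at hpow
  push_cast
  rw [mul_div_cancel_left₀ _ two_ne_zero]
  refine summable_of_isBigO_nat (Real.summable_nat_rpow.2 ?_) hpow
  rw [div_lt_iff₀ hδ] at hqδ
  linarith

end Regime

theorem tendsto_iSup_of_tendstoUniformly {ι α : Type*} {l : Filter ι} {f : ι → α → ℝ}
    (hf : ∀ i x, 0 ≤ f i x) (h : TendstoUniformly f 0 l) (s : ι → Set α) :
    Tendsto (fun i => ⨆ x : s i, f i x) l (𝓝 0) := by
  refine Metric.tendsto_nhds.2 fun r hr => ?_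
  filter_upwards [Metric.tendstoUniformly_iff.1 h (r / 2) (half_pos hr)] with i hi
  have hle : ⨆ x : s i, f i x ≤ r / 2 := Real.iSup_le (fun x => by
    simpa [dist_comm, abs_of_nonneg (hf i x)] using (hi x).le) (half_pos hr).le
  rw [Real.dist_0_eq_abs, abs_of_nonneg (Real.iSup_nonneg fun x => hf i _)]
  exact hle.trans_lt (half_lt_self hr)

section Asymptotics

variable {Ω : Type*} [MeasurableSpace Ω] {P : Measure Ω} {d K N B : ℕ → ℕ} {p m : ℝ≥0}
  {H : (M : ℕ) → ℤ → Matrix (Fin (d M)) (Fin (K M)) ℂ} {C : ℝ}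
  {ε : (M : ℕ) → ℤ → Ω → Fin (K M) → ℂ}

theorem ae_tendsto_factorizationBound (hp : 2 ≤ p)
    (hrate : Summable fun M => (((B M : ℝ) + 1) / N M) ^ (p / 2 : ℝ))
    (hH : ∀ᶠ M in atTop, HasMemoryBound (H M) C)
    (hε : ∀ M n, AEStronglyMeasurable (ε M n) P)
    (hm : ∀ M n, eLpNorm (fun ω => ‖ε M n ω‖₂) p P ≤ m) :
    ∀ᵐ ω ∂P, Tendsto (fun M => factorizationBound (H M) C (N M) (B M) fun n => ε M n ω)
      atTop (𝓝 0) := by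
  refine ae_tendsto_zero_of_eventually_eLpNorm_le (two_pos.trans_le hp).ne'
    (fun M => aestronglyMeasurable_factorizationBound (hε M) _ _) ?_
    (hH.mono fun M hHM => hHM.eLpNorm_factorizationBound_le hp (hε M) (hm M) _ _)
  have hpow : ∀ M, ENNReal.ofReal √((B M + 1) / N M) ^ (p : ℝ) =
      ENNReal.ofReal (((B M + 1) / N M) ^ (p / 2 : ℝ)) := fun M => by
    rw [ENNReal.ofReal_rpow_of_nonneg (Real.sqrt_nonneg _) p.coe_nonneg, Real.sqrt_eq_rpow,
      ← Real.rpow_mul (by positivity), one_div_mul_eq_div]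
  simp only [ENNReal.mul_rpow_of_nonneg _ _ p.coe_nonneg, hpow, ENNReal.tsum_mul_right]
  refine ENNReal.mul_ne_top hrate.tsum_ofReal_ne_top ?_
  finiteness

theorem eventually_add_one_le_of_summable (hp : p ≠ 0) (hN : ∀ᶠ M in atTop, 0 < N M)
    (hrate : Summable fun M => (((B M : ℝ) + 1) / N M) ^ (p / 2 : ℝ)) :
    ∀ᶠ M in atTop, B M + 1 ≤ N M := by
  filter_upwards [hN, hrate.tendsto_atTop_zero.eventually_lt_const one_pos] with M hNM hlt
  have hN' : (0 : ℝ) < N M := by exact_mod_cast hNM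
  have hp' : (0 : ℝ) < p / 2 := by positivity
  have hratio := (Real.rpow_lt_one_iff' (by positivity) hp').1 hlt
  rw [div_lt_one hN'] at hratio
  exact_mod_cast hratio.le

theorem mainTheorem5_general (hN : ∀ᶠ M in atTop, 0 < N M) (hp : 2 ≤ p)
    (hrate : Summable fun M => (((B M : ℝ) + 1) / N M) ^ (p / 2 : ℝ))
    (hH : ∀ᶠ M in atTop, HasMemoryBound (H M) C)
    (hε : ∀ M n, AEStronglyMeasurable (ε M n) P)
    (hm : ∀ M n, eLpNorm (fun ω => ‖ε M n ω‖₂) p P ≤ m)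
    {u : (M : ℕ) → ℤ → Ω → Fin (d M) → ℂ}
    (hu : ∀ M n, ∀ᵐ ω ∂P, u M n ω = ∑' k, H M k *ᵥ ε M (n - k) ω) :
    ∀ᵐ ω ∂P, TendstoUniformly
      (fun M (ν : ℝ) => ‖smoothedFourier (N M) (B M) (fun n => u M n ω) ν -
        transferFunction (H M) ν * smoothedFourier (N M) (B M) (fun n => ε M n ω) ν‖)
      0 atTop := by
  have hp0 : p ≠ 0 := (two_pos.trans_le hp).ne'
  have hsummable : ∀ᵐ ω ∂P, ∀ M, HasMemoryBound (H M) C →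
      ∀ n, Summable fun k => ‖H M k‖ * ‖ε M (n - k) ω‖₂ :=
    ae_all_iff.2 fun M => eventually_imp_distrib_left.2 fun hHM =>
      hHM.ae_summable_norm_mul (one_le_two.trans hp) (hε M) (hm M)
  have hfilter : ∀ᵐ ω ∂P, ∀ M n, u M n ω = ∑' k, H M k *ᵥ ε M (n - k) ω :=
    ae_all_iff.2 fun M => ae_all_iff.2 fun n => hu M n
  filter_upwards [hsummable, hfilter, ae_tendsto_factorizationBound hp hrate hH hε hm]
    with ω hsum huω hbound
  refine Metric.tendstoUniformly_iff.2 fun r hr => ?_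
  filter_upwards [hH, eventually_add_one_le_of_summable hp0 hN hrate,
    hbound.eventually_lt_const hr] with M hHM hBM hlt ν
  have hle := hHM.norm_smoothedFourier_sub_le (e := fun n => ε M n ω) (v := fun n => u M n ω)
    (hsum M hHM) (huω M) hBM ν
  rw [Pi.zero_apply, dist_zero_left, norm_norm]
  exact hle.trans_lt hlt

end Asymptotics

theorem mainTheorem5 {Ω : Type*} [MeasurableSpace Ω] (P : Measure Ω) [IsProbabilityMeasure P]
    (K : ℕ) (N B : ℕ → ℕ) (hregime : HighDimensionalRegime N B)
    (H : (M : ℕ) → ℤ → Matrix (Fin M) (Fin K) ℂ) (hH : MIMOFilterConditions H)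
    (ε : ℕ → ℤ → Ω → Fin K → ℂ) (hε : ∀ M, IsComplexGaussianWhiteNoise (ε M) P)
    (u : (M : ℕ) → ℤ → Ω → Fin M → ℂ)
    (hu : ∀ M n, ∀ᵐ ω ∂P, u M n ω = ∑' k : ℤ, H M k *ᵥ ε M (n - k) ω) :
    ∀ᵐ ω ∂P, Tendsto
      (fun M : ℕ => ⨆ ν : fourierFrequencies (N M),
        ‖smoothedFourier (N M) (B M) (fun n => u M n ω) ν -
          transferFunction (H M) ν * smoothedFourier (N M) (B M) (fun n => ε M n ω) ν‖)
      atTop (𝓝 0) := by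
  obtain ⟨C, hC⟩ := hH.memory
  obtain ⟨p, hp, hrate⟩ := hregime.exists_summable_rpow
  obtain ⟨m, hm⟩ := exists_eLpNorm_le_of_isComplexGaussianVector K (one_le_two.trans hp)
  have hmemory : ∀ᶠ M in atTop, HasMemoryBound (H M) C :=
    (eventually_ge_atTop 1).mono fun M hM => ⟨(hC M hM).1, (hC M hM).2⟩
  have hmeas : ∀ M n, AEStronglyMeasurable (ε M n) P := fun M n =>
    ((hε M).measurable n).aestronglyMeasurable
  filter_upwards [mainTheorem5_general hregime.eventually_pos hp hrate hmemory hmeas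
    (fun M n => hm ((hε M).gaussian n)) hu] with ω hω
  exact tendsto_iSup_of_tendstoUniformly (fun _ _ => norm_nonneg _) hω _
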